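/- Let $M$ be a smooth ($C^\infty$, Hausdorff) manifold of dimension $2n+1$ with a smooth contact metric structure $(\varphi,\xi,\eta,g)$. That is, $g$ is a Riemannian metric, $\varphi$ is an endomorphism field of $TM$, $\xi$ is a vector field and $\eta$ is a $1$-form such that $$\varphi^2=-\mathrm{Id}+\eta\otimes\xi,\qquad \eta(\xi)=1,\qquad g(\varphi X,\varphi Y)=g(X,Y)-\eta(X)\eta(Y),\qquad d\eta(X,Y)=g(X,\varphi Y),$$ where $d\eta(X,Y)=\tfrac12\big(X\eta(Y)-Y\eta(X)-\eta([X,Y])\big)$. Let $\nabla$ be the Levi-Civita connection of $g$, let $R_{XY}Z=\nabla_X\nabla_YZ-\nabla_Y\nabla_XZ-\nabla_{[X,Y]}Z$, and let $R(X,Y,Z,W)=-g(R_{XY}Z,W)$. Suppose that $M$ satisfies the identity (G1): $$R(X,Y,\varphi Z,\varphi W)-R(X,Y,Z,W)=g(Y,\varphi W)g(X,\varphi Z)-g(X,\varphi W)g(Y,\varphi Z)+g(X,W)g(Y,Z)-g(Y,W)g(X,Z)$$ for all smooth vector fields $X,Y,Z,W$ on $M$. Then $(\varphi,\xi,\eta,g)$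 is Sasakian, that is, the contact metric structure is normal: $[\varphi,\varphi]+2\,d\eta\otimes\xi=0$, where $$[\varphi,\varphi](X,Y)=\varphi^2[X,Y]+[\varphi X,\varphi Y]-\varphi[\varphi X,Y]-\varphi[X,\varphi Y].$$ -/

import Mathlib

open scoped Manifold ContDiff Bundle
open VectorField

noncomputable section

namespace ContactGeometry

section Connection

variable {E : Type*} [NormedAddCommGroup E] [NormedSpace ℝ E] [FiniteDimensional ℝ E]
  {H : Type*} [TopologicalSpace H] (I : ModelWithCorners ℝ E H)
  {M : Type*} [TopologicalSpace M] [ChartedSpace H M] [IsManifold I ∞ M]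
  [Bundle.RiemannianBundle (fun x : M ↦ TangentSpace I x)]

/-- `X` is a smooth vector field on `M`. -/
def IsSmoothField (X : Π x : M, TangentSpace I x) : Prop :=
  ContMDiff I I.tangent ∞ (fun x ↦ (⟨x, X x⟩ : TangentBundle I M))

/-- The derivative `X f` of the function `f` along the vector field `X`, at `x`. -/
def lieDeriv (X : Π x : M, TangentSpace I x) (f : M → ℝ) (x : M) : ℝ :=
  mvfderiv I f x (X x)

/-- The function `g(X, Y)`. -/
def metric (X Y : Π x : M, TangentSpace I x) (x : M) : ℝ := inner ℝ (X x) (Y x)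

/-- The right-hand side of the Koszul formula, i.e. `2 g(∇_X Y, Z)`. -/
def koszul (X Y Z : Π x : M, TangentSpace I x) (x : M) : ℝ :=
  lieDeriv I X (metric I Y Z) x + lieDeriv I Y (metric I X Z) x - lieDeriv I Z (metric I X Y) x
    + metric I (mlieBracket I X Y) Z x - metric I (mlieBracket I X Z) Y x
    - metric I (mlieBracket I Y Z) X x

instance instFiniteDimensionalTangent (x : M) : FiniteDimensional ℝ (TangentSpace I x) :=
  inferInstanceAs (FiniteDimensional ℝ E)

/-- The Levi-Civita connection `∇_X Y` of the metric, at `x`: the vector whose inner product with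
each vector `e` of an orthonormal basis of the tangent space is `1/2` of the Koszul expression,
where `e` is extended to a vector field that is smooth near `x`. -/
def leviCivita (X Y : Π x : M, TangentSpace I x) (x : M) : TangentSpace I x :=
  letI e := stdOrthonormalBasis ℝ (TangentSpace I x)
  ∑ i, ((1 / 2 : ℝ) * koszul I X Y (FiberBundle.extend E (e i)) x) • e i

/-- The curvature `R_{XY} Z = ∇_X ∇_Y Z - ∇_Y ∇_X Z - ∇_{[X, Y]} Z`. -/
def curvature (X Y Z : Π x : M, TangentSpace I x) (x : M) : TangentSpace I x :=
  leviCivita I X (leviCivita I Y Z) x - leviCivita I Y (leviCivita I X Z) x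
    - leviCivita I (mlieBracket I X Y) Z x

/-- The Riemann-Christoffel curvature tensor `R(X, Y, Z, W) = - g(R_{XY} Z, W)`. -/
def riemann (X Y Z W : Π x : M, TangentSpace I x) (x : M) : ℝ :=
  - metric I (curvature I X Y Z) W x

end Connection

variable {E : Type*} [NormedAddCommGroup E] [NormedSpace ℝ E] [FiniteDimensional ℝ E]
  {H : Type*} [TopologicalSpace H] (I : ModelWithCorners ℝ E H)
  (M : Type*) [TopologicalSpace M] [ChartedSpace H M] [IsManifold I ∞ M]
  [Bundle.RiemannianBundle (fun x : M ↦ TangentSpace I x)]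

/-- An almost contact metric structure `(φ, ξ, η)` on the Riemannian manifold `M`, whose metric `g`
is the given one: smooth tensor fields with `φ² = -1 + η ⊗ ξ`, `η(ξ) = 1` and
`g(φ X, φ Y) = g(X, Y) - η(X) η(Y)`. -/
structure AlmostContactMetricStructure where
  φ : Π x : M, TangentSpace I x →L[ℝ] TangentSpace I x
  ξ : Π x : M, TangentSpace I x
  η : Π x : M, TangentSpace I x →L[ℝ] ℝ
  smooth_φ : ContMDiff I (I.prod 𝓘(ℝ, E →L[ℝ] E)) ∞
    (fun x ↦ Bundle.TotalSpace.mk' (E →L[ℝ] E)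
      (E := fun x : M ↦ TangentSpace I x →L[ℝ] TangentSpace I x) x (φ x))
  smooth_ξ : IsSmoothField I ξ
  smooth_η : ContMDiff I (I.prod 𝓘(ℝ, E →L[ℝ] ℝ)) ∞
    (fun x ↦ Bundle.TotalSpace.mk' (E →L[ℝ] ℝ)
      (E := fun x : M ↦ TangentSpace I x →L[ℝ] Bundle.Trivial M ℝ x) x (η x))
  φ_φ : ∀ (x : M) (v : TangentSpace I x), φ x (φ x v) = - v + η x v • ξ x
  η_ξ : ∀ x : M, η x (ξ x) = 1
  inner_φ_φ : ∀ (x : M) (v w : TangentSpace I x),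
    inner ℝ (φ x v) (φ x w) = inner ℝ v w - η x v * η x w

namespace AlmostContactMetricStructure

variable {I M} (S : AlmostContactMetricStructure I M)

/-- The vector field `φ X`. -/
def phi (X : Π x : M, TangentSpace I x) (x : M) : TangentSpace I x := S.φ x (X x)

/-- The function `η(X)`. -/
def eta (X : Π x : M, TangentSpace I x) (x : M) : ℝ := S.η x (X x)

/-- The exterior derivative of `η`, with the usual normalization of contact metric geometry:
`dη(X, Y) = 1/2 (X η(Y) - Y η(X) - η([X, Y]))`. -/
def dEta (X Y : Π x : M, TangentSpace I x) (x : M) : ℝ :=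
  (1 / 2 : ℝ) * (lieDeriv I X (S.eta Y) x - lieDeriv I Y (S.eta X) x - S.eta (mlieBracket I X Y) x)

/-- The structure is a contact metric structure: `dη(X, Y) = g(X, φ Y)`. -/
def IsContactMetric : Prop :=
  ∀ X Y : Π x : M, TangentSpace I x, IsSmoothField I X → IsSmoothField I Y →
    ∀ x, S.dEta X Y x = metric I X (S.phi Y) x

/-- The Nijenhuis torsion
`[φ, φ](X, Y) = φ² [X, Y] + [φ X, φ Y] - φ [φ X, Y] - φ [X, φ Y]`. -/
def nijenhuis (X Y : Π x : M, TangentSpace I x) (x : M) : TangentSpace I x :=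
  S.φ x (S.φ x (mlieBracket I X Y x)) + mlieBracket I (S.phi X) (S.phi Y) x
    - S.φ x (mlieBracket I (S.phi X) Y x) - S.φ x (mlieBracket I X (S.phi Y) x)

/-- The structure is normal: `[φ, φ] + 2 dη ⊗ ξ = 0`. -/
def IsNormal : Prop :=
  ∀ X Y : Π x : M, TangentSpace I x, IsSmoothField I X → IsSmoothField I Y →
    ∀ x, S.nijenhuis X Y x + (2 * S.dEta X Y x) • S.ξ x = 0

/-- A Sasakian structure is a normal contact metric structure. -/
def IsSasakian : Prop := S.IsContactMetric ∧ S.IsNormal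

/-- The identity (G1). -/
def SatisfiesG1 : Prop :=
  ∀ X Y Z W : Π x : M, TangentSpace I x, IsSmoothField I X → IsSmoothField I Y →
    IsSmoothField I Z → IsSmoothField I W → ∀ x,
    riemann I X Y (S.phi Z) (S.phi W) x - riemann I X Y Z W x =
      metric I Y (S.phi W) x * metric I X (S.phi Z) x
        - metric I X (S.phi W) x * metric I Y (S.phi Z) x
        + metric I X W x * metric I Y Z x - metric I Y W x * metric I X Z x

end AlmostContactMetricStructure

end ContactGeometry

end

set_option linter.unusedSectionVars false

namespace ContactGeometry

section Calculus

variable {E : Type*} [NormedAddCommGroup E] [NormedSpace ℝ E] [FiniteDimensional ℝ E]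
  {H : Type*} [TopologicalSpace H] {I : ModelWithCorners ℝ E H}
  {M : Type*} [TopologicalSpace M] [ChartedSpace H M] [IsManifold I ∞ M]

/-- The vector field `X` is differentiable at `x`. -/
def DiffFieldAt (I : ModelWithCorners ℝ E H) [IsManifold I ∞ M] (X : Π x : M, TangentSpace I x)
    (x : M) : Prop :=
  MDifferentiableAt I I.tangent (fun x ↦ (⟨x, X x⟩ : TangentBundle I M)) x

variable {X Y Z : Π x : M, TangentSpace I x} {f f' : M → ℝ} {x : M}

lemma IsSmoothField.diffAt (hX : IsSmoothField I X) (x : M) : DiffFieldAt I X x :=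
  hX.contMDiffAt.mdifferentiableAt (by simp)

lemma IsSmoothField.add (hX : IsSmoothField I X) (hY : IsSmoothField I Y) :
    IsSmoothField I (X + Y) :=
  ContMDiff.add_section hX hY

lemma IsSmoothField.neg (hX : IsSmoothField I X) : IsSmoothField I (-X) :=
  ContMDiff.neg_section hX

lemma IsSmoothField.sub (hX : IsSmoothField I X) (hY : IsSmoothField I Y) :
    IsSmoothField I (X - Y) :=
  ContMDiff.sub_section hX hY

lemma IsSmoothField.const_smul (c : ℝ) (hX : IsSmoothField I X) :
    IsSmoothField I (c • X) :=
  ContMDiff.const_smul_section hX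

lemma IsSmoothField.smul (hf : ContMDiff I 𝓘(ℝ) ∞ f) (hX : IsSmoothField I X) :
    IsSmoothField I (f • X) :=
  ContMDiff.smul_section hf hX

lemma isSmoothField_zero : IsSmoothField I (0 : Π x : M, TangentSpace I x) :=
  Bundle.contMDiff_zeroSection ℝ (TangentSpace I : M → Type _)

lemma IsSmoothField.mlieBracket (hX : IsSmoothField I X) (hY : IsSmoothField I Y) :
    IsSmoothField I (mlieBracket I X Y) :=
  have := FiniteDimensional.complete ℝ E
  have : IsManifold I ((⊤ : ℕ∞) + 1) M := by
    simpa using (inferInstance : IsManifold I ∞ M)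
  have : IsManifold I (minSmoothness ℝ 2) M := by
    rw [minSmoothness_of_isRCLikeNormedField]; infer_instance
  ContDiff.mlieBracket_vectorField (n := ⊤) (m := ⊤) hX hY (by simp)

lemma lieDeriv_add (hf : MDifferentiableAt I 𝓘(ℝ) f x) (hf' : MDifferentiableAt I 𝓘(ℝ) f' x) :
    lieDeriv I X (f + f') x = lieDeriv I X f x + lieDeriv I X f' x := by
  simp [lieDeriv, mvfderiv_add hf hf']

lemma lieDeriv_neg : lieDeriv I X (-f) x = - lieDeriv I X f x := by
  simp [lieDeriv, mvfderiv_neg]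

lemma lieDeriv_sub (hf : MDifferentiableAt I 𝓘(ℝ) f x) (hf' : MDifferentiableAt I 𝓘(ℝ) f' x) :
    lieDeriv I X (f - f') x = lieDeriv I X f x - lieDeriv I X f' x := by
  simp [lieDeriv, mvfderiv_sub hf hf']

lemma lieDeriv_mul (hf : MDifferentiableAt I 𝓘(ℝ) f x) (hf' : MDifferentiableAt I 𝓘(ℝ) f' x) :
    lieDeriv I X (f * f') x = f x * lieDeriv I X f' x + f' x * lieDeriv I X f x := by
  simp [lieDeriv, mvfderiv_mul hf hf']

lemma lieDeriv_const (c : ℝ) : lieDeriv I X (fun _ ↦ c) x = 0 := by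
  simp [lieDeriv, mvfderiv_const]

lemma lieDeriv_field_smul : lieDeriv I (f • X) f' x = f x * lieDeriv I X f' x := by
  simp [lieDeriv]

lemma lieDeriv_field_add :
    lieDeriv I (X + Y) f' x = lieDeriv I X f' x + lieDeriv I Y f' x := by
  simp [lieDeriv]

lemma contMDiff_lieDeriv (hX : IsSmoothField I X) (hf : ContMDiff I 𝓘(ℝ) ∞ f) :
    ContMDiff I 𝓘(ℝ) ∞ (lieDeriv I X f) := by
  have h : ContMDiff I.tangent 𝓘(ℝ).tangent ∞ (tangentMap I 𝓘(ℝ) f) :=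
    hf.contMDiff_tangentMap (by simp)
  have := (contMDiff_snd_tangentBundle_modelSpace ℝ 𝓘(ℝ)).comp (h.comp hX)
  exact this

lemma bracket_smul_right (hf : MDifferentiableAt I 𝓘(ℝ) f x) (hY : DiffFieldAt I Y x) :
    mlieBracket I X (f • Y) x = lieDeriv I X f x • Y x + f x • mlieBracket I X Y x :=
  have := FiniteDimensional.complete ℝ E
  mlieBracket_smul_right hf hY

lemma bracket_add_right (hY : DiffFieldAt I Y x) (hZ : DiffFieldAt I Z x) :
    mlieBracket I X (Y + Z) x = mlieBracket I X Y x + mlieBracket I X Z x :=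
  have := FiniteDimensional.complete ℝ E
  mlieBracket_add_right hY hZ

lemma bracket_neg_right (hY : DiffFieldAt I Y x) :
    mlieBracket I X (-Y) x = - mlieBracket I X Y x := by
  have := FiniteDimensional.complete ℝ E
  have := mlieBracket_const_smul_right (I := I) (V := X) (c := (-1 : ℝ)) hY
  simpa using this

lemma bracket_swap : mlieBracket I X Y x = - mlieBracket I Y X x :=
  mlieBracket_swap_apply

lemma bracket_jacobi (hX : IsSmoothField I X) (hY : IsSmoothField I Y) (hZ : IsSmoothField I Z)
    (x : M) :
    mlieBracket I X (mlieBracket I Y Z) x =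
      mlieBracket I (mlieBracket I X Y) Z x + mlieBracket I Y (mlieBracket I X Z) x := by
  have := FiniteDimensional.complete ℝ E
  have : IsManifold I (minSmoothness ℝ 3) M := by
    rw [minSmoothness_of_isRCLikeNormedField]; infer_instance
  have h2 : minSmoothness ℝ 2 ≤ ∞ := by
    rw [minSmoothness_of_isRCLikeNormedField]; exact ENat.LEInfty.out
  exact leibniz_identity_mlieBracket_apply (hX.contMDiffAt.of_le h2) (hY.contMDiffAt.of_le h2)
    (hZ.contMDiffAt.of_le h2)

/-- The bracket acts on functions as the commutator of derivations, at points where some smooth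
vector field does not vanish. -/
lemma lieDeriv_bracket (hX : IsSmoothField I X) (hY : IsSmoothField I Y) (hZ : IsSmoothField I Z)
    (hf : ContMDiff I 𝓘(ℝ) ∞ f) (hZx : Z x ≠ 0) :
    lieDeriv I (mlieBracket I X Y) f x =
      lieDeriv I X (lieDeriv I Y f) x - lieDeriv I Y (lieDeriv I X f) x := by
  have hd {f : M → ℝ} (hf : ContMDiff I 𝓘(ℝ) ∞ f) (y : M) : MDifferentiableAt I 𝓘(ℝ) f y :=
    hf.contMDiffAt.mdifferentiableAt (by simp)
  have e {V : Π x : M, TangentSpace I x} :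
      mlieBracket I V (f • Z) = lieDeriv I V f • Z + f • mlieBracket I V Z :=
    funext fun y ↦ bracket_smul_right (hd hf y) (hZ.diffAt y)
  have key := bracket_jacobi hX hY (hZ.smul hf) x
  have hXf := contMDiff_lieDeriv hX hf
  have hYf := contMDiff_lieDeriv hY hf
  rw [e, e, e,
    bracket_add_right ((hZ.smul hYf).diffAt x) (((hY.mlieBracket hZ).smul hf).diffAt x),
    bracket_add_right ((hZ.smul hXf).diffAt x) (((hX.mlieBracket hZ).smul hf).diffAt x),
    bracket_smul_right (hd hYf x) (hZ.diffAt x), bracket_smul_right (hd hXf x) (hZ.diffAt x),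
    bracket_smul_right (hd hf x) ((hY.mlieBracket hZ).diffAt x),
    bracket_smul_right (hd hf x) ((hX.mlieBracket hZ).diffAt x),
    bracket_jacobi hX hY hZ] at key
  have : (lieDeriv I (mlieBracket I X Y) f x -
      (lieDeriv I X (lieDeriv I Y f) x - lieDeriv I Y (lieDeriv I X f) x)) • Z x = 0 := by
    simp only [Pi.add_apply, Pi.smul_apply'] at key
    rw [← sub_eq_zero, ← neg_eq_zero] at key
    rw [← key]
    module
  exact sub_eq_zero.1 ((smul_eq_zero.1 this).resolve_right hZx)

end Calculus

section Koszul

variable {E : Type*} [NormedAddCommGroup E] [NormedSpace ℝ E] [FiniteDimensional ℝ E]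
  {H : Type*} [TopologicalSpace H] {I : ModelWithCorners ℝ E H}
  {M : Type*} [TopologicalSpace M] [ChartedSpace H M] [IsManifold I ∞ M]
  [Bundle.RiemannianBundle (fun x : M ↦ TangentSpace I x)]
  [IsContMDiffRiemannianBundle I ∞ E (fun x : M ↦ TangentSpace I x)]

variable {X Y Z : Π x : M, TangentSpace I x} {f : M → ℝ} {x : M}

lemma contMDiff_metric (hX : IsSmoothField I X) (hY : IsSmoothField I Y) :
    ContMDiff I 𝓘(ℝ) ∞ (metric I X Y) :=
  ContMDiff.inner_bundle (F := E) hX hY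

lemma DiffFieldAt.metric (hX : DiffFieldAt I X x) (hY : DiffFieldAt I Y x) :
    MDifferentiableAt I 𝓘(ℝ) (metric I X Y) x :=
  MDifferentiableAt.inner_bundle (F := E) hX hY

lemma metric_comm : metric I X Y = metric I Y X :=
  funext fun _ ↦ real_inner_comm _ _

lemma metric_smul_right : metric I X (f • Y) = f * metric I X Y :=
  funext fun _ ↦ real_inner_smul_right _ _ _

lemma metric_add_right : metric I X (Y + Z) = metric I X Y + metric I X Z :=
  funext fun _ ↦ inner_add_right _ _ _

lemma tensorialAt_koszul (hX : DiffFieldAt I X x) (hY : DiffFieldAt I Y x) :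
    TensorialAt I E (fun Z : Π x : M, TangentSpace I x ↦ koszul I X Y Z x) x where
  smul {f Z} hf hZ := by
    have hZ : DiffFieldAt I Z x := hZ
    simp only [koszul]
    rw [metric_smul_right, metric_smul_right, lieDeriv_mul hf (hY.metric hZ),
      lieDeriv_mul hf (hX.metric hZ), lieDeriv_field_smul, metric_smul_right]
    simp only [metric, bracket_smul_right hf hZ, inner_add_left, real_inner_smul_left,
      Pi.mul_apply, smul_eq_mul]
    rw [real_inner_comm (Z x) (Y x), real_inner_comm (Z x) (X x)]
    ring
  add {Z Z'} hZ hZ' := by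
    have hZ : DiffFieldAt I Z x := hZ
    have hZ' : DiffFieldAt I Z' x := hZ'
    simp only [koszul]
    rw [metric_add_right, metric_add_right, lieDeriv_add (hY.metric hZ) (hY.metric hZ'),
      lieDeriv_add (hX.metric hZ) (hX.metric hZ'), lieDeriv_field_add, metric_add_right]
    simp only [metric, bracket_add_right hZ hZ', inner_add_left, Pi.add_apply]
    ring

/-- The Levi-Civita connection is determined by the Koszul formula. -/
lemma inner_leviCivita (hX : IsSmoothField I X) (hY : IsSmoothField I Y) (hZ : IsSmoothField I Z)
    (x : M) : inner ℝ (leviCivita I X Y x) (Z x) = 1 / 2 * koszul I X Y Z x := by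
  have hT := tensorialAt_koszul (hX.diffAt x) (hY.diffAt x)
  have hZx : DiffFieldAt I Z x := hZ.diffAt x
  rw [← TensorialAt.mkHom_apply hT hZx]
  set e := stdOrthonormalBasis ℝ (TangentSpace I x)
  conv_rhs => rw [← e.sum_repr (Z x), map_sum]
  simp only [leviCivita, sum_inner, real_inner_smul_left, map_smul, smul_eq_mul, Finset.mul_sum,
    e.repr_apply_apply, TensorialAt.mkHom_apply_eq_extend]
  refine Finset.sum_congr rfl fun i _ ↦ ?_
  ring

variable [T2Space M]

lemma exists_isSmoothField_eq (v : TangentSpace I x) :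
    ∃ Z : Π x : M, TangentSpace I x, IsSmoothField I Z ∧ Z x = v := by
  obtain ⟨s, hs, hsv⟩ := FiberBundle.exists_contMDiffOn_extend (k := ∞) I E v
  obtain ⟨f, hf⟩ := ((SmoothBumpFunction.nhds_basis_tsupport (I := I) x).mem_iff).1
    (interior_mem_nhds.2 hs)
  refine ⟨(f : M → ℝ) • FiberBundle.extend E v, ?_, ?_⟩
  · exact ContMDiffOn.smul_section_of_tsupport f.contMDiff.contMDiffOn isOpen_interior hf.2
      (hsv.mono interior_subset)
  · simp

lemma eq_of_forall_inner_eq {u w : TangentSpace I x}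
    (h : ∀ Z : Π x : M, TangentSpace I x, IsSmoothField I Z →
      inner ℝ u (Z x) = inner ℝ w (Z x)) : u = w := by
  refine ext_inner_right ℝ fun v ↦ ?_
  obtain ⟨Z, hZ, rfl⟩ := exists_isSmoothField_eq v
  exact h Z hZ

lemma lieDeriv_metric (hX : IsSmoothField I X) (hY : IsSmoothField I Y) (hZ : IsSmoothField I Z)
    (x : M) : lieDeriv I X (metric I Y Z) x =
      inner ℝ (leviCivita I X Y x) (Z x) + inner ℝ (leviCivita I X Z x) (Y x) := by
  rw [inner_leviCivita hX hY hZ, inner_leviCivita hX hZ hY]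
  simp only [koszul, metric_comm (X := Z) (Y := Y)]
  simp only [metric, bracket_swap (X := Z) (Y := Y), inner_neg_left]
  ring

lemma leviCivita_sub_leviCivita (hX : IsSmoothField I X) (hY : IsSmoothField I Y) (x : M) :
    leviCivita I X Y x - leviCivita I Y X x = mlieBracket I X Y x := by
  refine eq_of_forall_inner_eq fun Z hZ ↦ ?_
  rw [inner_sub_left, inner_leviCivita hX hY hZ, inner_leviCivita hY hX hZ]
  simp only [koszul, metric_comm (X := Y) (Y := X)]
  simp only [metric, bracket_swap (X := Y) (Y := X), inner_neg_left]
  ring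

lemma leviCivita_neg_right (hX : IsSmoothField I X) (hY : IsSmoothField I Y) (x : M) :
    leviCivita I X (-Y) x = - leviCivita I X Y x := by
  refine eq_of_forall_inner_eq fun Z hZ ↦ ?_
  have h : metric I (-Y) Z = - metric I Y Z := funext fun _ ↦ inner_neg_left _ _
  have := lieDeriv_metric hX hY.neg hZ x
  rw [h, lieDeriv_neg, lieDeriv_metric hX hY hZ, Pi.neg_apply, inner_neg_right] at this
  rw [inner_neg_left]
  linarith

lemma leviCivita_zero_right (hX : IsSmoothField I X) (x : M) :
    leviCivita I X 0 x = 0 := by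
  have := leviCivita_neg_right hX isSmoothField_zero x
  rw [neg_zero, eq_neg_iff_add_eq_zero, ← two_smul ℝ] at this
  exact (smul_eq_zero.1 this).resolve_left two_ne_zero

end Koszul

namespace AlmostContactMetricStructure

variable {E : Type*} [NormedAddCommGroup E] [NormedSpace ℝ E] [FiniteDimensional ℝ E]
  {H : Type*} [TopologicalSpace H] {I : ModelWithCorners ℝ E H}
  {M : Type*} [TopologicalSpace M] [ChartedSpace H M] [IsManifold I ∞ M]
  [Bundle.RiemannianBundle (fun x : M ↦ TangentSpace I x)]
  (S : AlmostContactMetricStructure I M)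

section Algebra

variable (x : M) (v w : TangentSpace I x)

lemma ξ_ne_zero : S.ξ x ≠ 0 := fun h ↦ by simpa [h] using S.η_ξ x

lemma φ_ξ : S.φ x (S.ξ x) = 0 := by
  have h0 : S.φ x (S.φ x (S.ξ x)) = 0 := by simp [S.φ_φ, S.η_ξ]
  have h1 : S.φ x (S.ξ x) = S.η x (S.φ x (S.ξ x)) • S.ξ x := by
    have := S.φ_φ x (S.φ x (S.ξ x))
    rw [h0, map_zero] at this
    exact (neg_add_eq_zero.1 this.symm)
  rw [h1, map_smul, smul_eq_zero] at h0
  rcases h0 with h0 | h0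
  · rw [h1, h0, zero_smul]
  · exact h0

lemma η_φ : S.η x (S.φ x v) = 0 := by
  have h := S.φ_φ x (S.φ x v)
  rw [S.φ_φ x v, map_add, map_neg, map_smul, S.φ_ξ, smul_zero, add_zero] at h
  exact (smul_eq_zero.1 (left_eq_add.1 h)).resolve_right (S.ξ_ne_zero x)

lemma inner_ξ_right : inner ℝ v (S.ξ x) = S.η x v := by
  have := S.inner_φ_φ x v (S.ξ x)
  rw [S.φ_ξ, inner_zero_right, S.η_ξ] at this
  linarith

lemma inner_ξ_left : inner ℝ (S.ξ x) v = S.η x v := by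
  rw [real_inner_comm, inner_ξ_right]

lemma inner_φ_left : inner ℝ (S.φ x v) w = - inner ℝ v (S.φ x w) := by
  have := S.inner_φ_φ x v (S.φ x w)
  rw [S.φ_φ, S.η_φ, inner_add_right, inner_neg_right, real_inner_smul_right, inner_ξ_right,
    S.η_φ] at this
  linarith

end Algebra

variable {S} {X Y Z : Π x : M, TangentSpace I x}

lemma isSmoothField_phi (hX : IsSmoothField I X) : IsSmoothField I (S.phi X) :=
  ContMDiff.clm_bundle_apply S.smooth_φ hX

lemma contMDiff_eta (hX : IsSmoothField I X) : ContMDiff I 𝓘(ℝ) ∞ (S.eta X) := by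
  have := ContMDiff.clm_bundle_apply (E₂ := Bundle.Trivial M ℝ) S.smooth_η hX
  intro x
  exact ((Bundle.contMDiffAt_totalSpace).1 (this x)).2

lemma differentiableAt_eta (hX : IsSmoothField I X) (x : M) :
    MDifferentiableAt I 𝓘(ℝ) (S.eta X) x :=
  (contMDiff_eta hX).contMDiffAt.mdifferentiableAt (by simp)

lemma phi_ξ : S.phi S.ξ = 0 := funext S.φ_ξ

lemma eta_ξ : S.eta S.ξ = fun _ ↦ 1 := funext S.η_ξ

lemma phi_apply (x : M) : S.phi X x = S.φ x (X x) := rfl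

lemma eta_apply (x : M) : S.eta X x = S.η x (X x) := rfl

section Contact

lemma lieDeriv_eta_sub (hS : S.IsContactMetric) (hX : IsSmoothField I X) (hY : IsSmoothField I Y)
    (x : M) :
    lieDeriv I X (S.eta Y) x - lieDeriv I Y (S.eta X) x =
      S.eta (mlieBracket I X Y) x + 2 * metric I X (S.phi Y) x := by
  have := hS X Y hX hY x
  rw [dEta] at this
  linarith

lemma metric_phi_eq (hS : S.IsContactMetric) (hX : IsSmoothField I X) (hY : IsSmoothField I Y) :
    metric I X (S.phi Y) = (fun _ ↦ (1 / 2 : ℝ)) * (lieDeriv I X (S.eta Y)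
      - lieDeriv I Y (S.eta X) - S.eta (mlieBracket I X Y)) :=
  funext fun x ↦ (hS X Y hX hY x).symm

lemma lieDeriv_ξ_eta (hS : S.IsContactMetric) (hX : IsSmoothField I X) (x : M) :
    lieDeriv I S.ξ (S.eta X) x = S.η x (mlieBracket I S.ξ X x) := by
  have := lieDeriv_eta_sub hS S.smooth_ξ hX x
  rw [eta_ξ, lieDeriv_const] at this
  simpa [metric, inner_ξ_left, phi_apply, η_φ, eta_apply] using this

/-- The form `dη` is closed. -/
lemma cyclic_lieDeriv_metric_phi (hS : S.IsContactMetric) (hX : IsSmoothField I X)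
    (hY : IsSmoothField I Y) (hZ : IsSmoothField I Z) (x : M) :
    lieDeriv I X (metric I Y (S.phi Z)) x + lieDeriv I Y (metric I Z (S.phi X)) x
      + lieDeriv I Z (metric I X (S.phi Y)) x =
    metric I (mlieBracket I X Y) (S.phi Z) x + metric I (mlieBracket I Y Z) (S.phi X) x
      + metric I (mlieBracket I Z X) (S.phi Y) x := by
  have hd {f : M → ℝ} (hf : ContMDiff I 𝓘(ℝ) ∞ f) : MDifferentiableAt I 𝓘(ℝ) f x :=
    hf.contMDiffAt.mdifferentiableAt (by simp)
  have e {X Y Z : Π x : M, TangentSpace I x} (hX : IsSmoothField I X) (hY : IsSmoothField I Y)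
      (hZ : IsSmoothField I Z) : lieDeriv I X (metric I Y (S.phi Z)) x =
        (1 / 2 : ℝ) * (lieDeriv I X (lieDeriv I Y (S.eta Z)) x
          - lieDeriv I X (lieDeriv I Z (S.eta Y)) x
          - lieDeriv I X (S.eta (mlieBracket I Y Z)) x) := by
    have h1 := contMDiff_lieDeriv hY (contMDiff_eta (S := S) hZ)
    have h2 := contMDiff_lieDeriv hZ (contMDiff_eta (S := S) hY)
    have h3 := contMDiff_eta (S := S) (hY.mlieBracket hZ)
    rw [metric_phi_eq hS hY hZ, lieDeriv_mul mdifferentiableAt_const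
      (((hd h1).sub (hd h2)).sub (hd h3)),
      lieDeriv_sub ((hd h1).sub (hd h2)) (hd h3), lieDeriv_sub (hd h1) (hd h2), lieDeriv_const]
    ring
  rw [e hX hY hZ, e hY hZ hX, e hZ hX hY, metric_phi_eq hS (hX.mlieBracket hY) hZ,
    metric_phi_eq hS (hY.mlieBracket hZ) hX, metric_phi_eq hS (hZ.mlieBracket hX) hY]
  simp only [Pi.mul_apply, Pi.sub_apply]
  rw [lieDeriv_bracket hX hY S.smooth_ξ (contMDiff_eta hZ) (S.ξ_ne_zero x),
    lieDeriv_bracket hY hZ S.smooth_ξ (contMDiff_eta hX) (S.ξ_ne_zero x),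
    lieDeriv_bracket hZ hX S.smooth_ξ (contMDiff_eta hY) (S.ξ_ne_zero x)]
  have j := congrArg (S.η x) (bracket_jacobi hX hY hZ x)
  rw [bracket_swap (X := X) (Y := mlieBracket I Y Z), mlieBracket_swap (V := X) (W := Z),
    bracket_neg_right ((hZ.mlieBracket hX).diffAt x), bracket_swap (X := Y), neg_neg,
    map_add, map_neg] at j
  simp only [eta_apply]
  linarith

/-- The form `dη` is invariant under the flow of `ξ`. -/
lemma lieDeriv_ξ_metric_phi (hS : S.IsContactMetric) (hX : IsSmoothField I X)
    (hY : IsSmoothField I Y) (x : M) :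
    lieDeriv I S.ξ (metric I X (S.phi Y)) x =
      metric I (mlieBracket I S.ξ X) (S.phi Y) x + metric I X (S.phi (mlieBracket I S.ξ Y)) x := by
  have h := cyclic_lieDeriv_metric_phi hS S.smooth_ξ hX hY x
  have h1 : metric I Y (S.phi S.ξ) = fun _ ↦ 0 := by
    rw [phi_ξ]; exact funext fun _ ↦ inner_zero_right _
  have h2 : metric I S.ξ (S.phi X) = fun _ ↦ 0 := funext fun x ↦ by
    rw [metric, inner_ξ_left, phi_apply, η_φ]
  rw [h1, h2, lieDeriv_const, lieDeriv_const, phi_ξ] at h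
  simp only [metric, phi_apply, Pi.zero_apply, inner_zero_right,
    bracket_swap (X := Y) (Y := S.ξ), inner_neg_left] at h ⊢
  rw [← real_inner_comm (X x), inner_φ_left]
  linarith

variable (S) in
/-- The tensor field `h = 1/2 L_ξ φ`. -/
noncomputable def h (X : Π x : M, TangentSpace I x) : Π x : M, TangentSpace I x :=
  (1 / 2 : ℝ) • (mlieBracket I S.ξ (S.phi X) - S.phi (mlieBracket I S.ξ X))

variable (S) in
/-- The tensor field `-φ h`, the symmetric part of `∇ ξ`. -/
noncomputable def s (X : Π x : M, TangentSpace I x) : Π x : M, TangentSpace I x :=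
  - S.phi (S.h X)

lemma isSmoothField_h (hX : IsSmoothField I X) : IsSmoothField I (S.h X) :=
  ((S.smooth_ξ.mlieBracket (isSmoothField_phi hX)).sub
    (isSmoothField_phi (S.smooth_ξ.mlieBracket hX))).const_smul _

lemma isSmoothField_s (hX : IsSmoothField I X) : IsSmoothField I (S.s X) :=
  (isSmoothField_phi (isSmoothField_h hX)).neg

lemma h_apply (x : M) : S.h X x =
    (1 / 2 : ℝ) • (mlieBracket I S.ξ (S.phi X) x - S.φ x (mlieBracket I S.ξ X x)) := rfl

lemma s_apply (x : M) : S.s X x = - S.φ x (S.h X x) := rfl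

lemma η_s (x : M) : S.η x (S.s X x) = 0 := by
  rw [s_apply, map_neg, η_φ, neg_zero]

lemma s_ξ : S.s S.ξ = 0 := by
  funext x
  rw [s_apply, h_apply, phi_ξ, mlieBracket_self, mlieBracket_zero_right]
  simp

lemma η_bracket_ξ_phi (hS : S.IsContactMetric) (hX : IsSmoothField I X) (x : M) :
    S.η x (mlieBracket I S.ξ (S.phi X) x) = 0 := by
  rw [← lieDeriv_ξ_eta hS (isSmoothField_phi hX)]
  have : S.eta (S.phi X) = fun _ ↦ 0 := funext fun x ↦ S.η_φ x _
  rw [this, lieDeriv_const]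

lemma η_h (hS : S.IsContactMetric) (hX : IsSmoothField I X) (x : M) : S.η x (S.h X x) = 0 := by
  rw [h_apply, map_smul, map_sub, η_φ, η_bracket_ξ_phi hS hX, sub_zero, smul_zero]

lemma phi_s (hS : S.IsContactMetric) (hX : IsSmoothField I X) : S.phi (S.s X) = S.h X := by
  funext x
  rw [phi_apply, s_apply, map_neg, φ_φ, η_h hS hX, zero_smul, add_zero, neg_neg]

lemma s_phi (hS : S.IsContactMetric) (hX : IsSmoothField I X) : S.s (S.phi X) = - S.h X := by
  funext x
  have e : S.phi (S.phi X) = -X + S.eta X • S.ξ := funext fun x ↦ S.φ_φ x _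
  rw [Pi.neg_apply, s_apply, h_apply, h_apply, e, bracket_add_right (hX.neg.diffAt x)
    ((S.smooth_ξ.smul (contMDiff_eta hX)).diffAt x), bracket_neg_right (hX.diffAt x),
    bracket_smul_right (differentiableAt_eta hX x) (S.smooth_ξ.diffAt x), mlieBracket_self]
  simp only [map_smul, map_sub, map_add, map_neg, φ_ξ, S.φ_φ, η_bracket_ξ_phi hS hX,
    Pi.zero_apply, map_zero]
  module

lemma phi_add : S.phi (X + Y) = S.phi X + S.phi Y := funext fun x ↦ map_add (S.φ x) _ _

lemma phi_neg : S.phi (-X) = - S.phi X := funext fun x ↦ map_neg (S.φ x) _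

lemma s_add (hX : IsSmoothField I X) (hY : IsSmoothField I Y) :
    S.s (X + Y) = S.s X + S.s Y := by
  funext x
  rw [Pi.add_apply, s_apply, s_apply, s_apply, h_apply, h_apply, h_apply, phi_add,
    bracket_add_right ((isSmoothField_phi hX).diffAt x) ((isSmoothField_phi hY).diffAt x),
    bracket_add_right (hX.diffAt x) (hY.diffAt x)]
  simp only [map_smul, map_sub, map_add]
  module

lemma s_neg (hX : IsSmoothField I X) : S.s (-X) = - S.s X := by
  funext x
  rw [Pi.neg_apply, s_apply, s_apply, h_apply, h_apply, phi_neg,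
    bracket_neg_right ((isSmoothField_phi hX).diffAt x), bracket_neg_right (hX.diffAt x)]
  simp only [map_smul, map_sub, map_neg]
  module

lemma phi_h : S.phi (S.h X) = - S.s X := by
  rw [s, neg_neg]

variable [IsContMDiffRiemannianBundle I ∞ E (fun x : M ↦ TangentSpace I x)]

/-- The Lie derivative of the metric along `ξ` is `2 g(·, s ·)`. -/
lemma lieDeriv_ξ_metric (hS : S.IsContactMetric) (hX : IsSmoothField I X)
    (hY : IsSmoothField I Y) (x : M) :
    lieDeriv I S.ξ (metric I X Y) x = inner ℝ (mlieBracket I S.ξ X x) (Y x)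
      + inner ℝ (X x) (mlieBracket I S.ξ Y x) + 2 * inner ℝ (X x) (S.s Y x) := by
  have e : metric I X Y = -(metric I X (S.phi (S.phi Y))) + S.eta X * S.eta Y := by
    funext x
    simp only [metric, phi_apply, φ_φ, eta_apply, Pi.add_apply, Pi.neg_apply, Pi.mul_apply,
      inner_add_right, inner_neg_right, real_inner_smul_right, inner_ξ_right]
    ring
  have hd := ((contMDiff_metric hX (isSmoothField_phi (S := S)
    (isSmoothField_phi (S := S) hY))).contMDiffAt (x := x)).mdifferentiableAt (by simp)
  rw [e, lieDeriv_add hd.neg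
    ((differentiableAt_eta hX x).mul (differentiableAt_eta hY x)), lieDeriv_neg,
    lieDeriv_mul (differentiableAt_eta hX x) (differentiableAt_eta hY x),
    lieDeriv_ξ_eta hS hX, lieDeriv_ξ_eta hS hY,
    lieDeriv_ξ_metric_phi hS hX (isSmoothField_phi hY)]
  simp only [metric, phi_apply, s_apply, h_apply, φ_φ, eta_apply, map_smul, map_sub,
    inner_add_right, inner_neg_right, inner_sub_right, real_inner_smul_right, inner_ξ_right]
  ring

lemma inner_s_comm (hS : S.IsContactMetric) (hX : IsSmoothField I X)
    (hY : IsSmoothField I Y) (x : M) :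
    inner ℝ (S.s X x) (Y x) = inner ℝ (X x) (S.s Y x) := by
  have h1 := lieDeriv_ξ_metric hS hX hY x
  have h2 := lieDeriv_ξ_metric hS hY hX x
  rw [metric_comm, h1, real_inner_comm (X x) (mlieBracket I S.ξ Y x),
    real_inner_comm (Y x) (mlieBracket I S.ξ X x)] at h2
  rw [real_inner_comm]
  linarith

variable [T2Space M]

lemma leviCivita_ξ_right (hS : S.IsContactMetric) (hX : IsSmoothField I X) :
    leviCivita I X S.ξ = - S.phi X + S.s X := by
  funext x
  refine eq_of_forall_inner_eq fun Z hZ ↦ ?_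
  have e {Y : Π x : M, TangentSpace I x} : metric I S.ξ Y = S.eta Y :=
    funext fun x ↦ S.inner_ξ_left x _
  rw [inner_leviCivita hX S.smooth_ξ hZ, koszul, metric_comm (X := X) (Y := S.ξ), e, e,
    lieDeriv_ξ_metric hS hX hZ]
  have h1 := lieDeriv_eta_sub hS hX hZ x
  simp only [metric, eta_apply, phi_apply, bracket_swap (X := X) (Y := S.ξ), inner_neg_left,
    inner_ξ_right, Pi.add_apply, Pi.neg_apply, inner_add_left, inner_φ_left,
    inner_s_comm hS hX hZ] at h1 ⊢
  rw [real_inner_comm (X x) (mlieBracket I S.ξ Z x)]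
  linarith

lemma leviCivita_ξ_left (hS : S.IsContactMetric) (hX : IsSmoothField I X) :
    leviCivita I S.ξ X = - S.phi X + S.s X + mlieBracket I S.ξ X := by
  funext x
  rw [Pi.add_apply, ← leviCivita_ξ_right hS hX, ← leviCivita_sub_leviCivita S.smooth_ξ hX]
  abel

lemma curvature_zero_right (hX : IsSmoothField I X) (hY : IsSmoothField I Y) (x : M) :
    curvature I X Y 0 x = 0 := by
  have e {Y : Π x : M, TangentSpace I x} (hY : IsSmoothField I Y) : leviCivita I Y 0 = 0 :=
    funext (leviCivita_zero_right hY)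
  simp [curvature, e hX, e hY, e (hX.mlieBracket hY)]

/-- The curvature identity `R_{XY} ξ = η(Y) X - η(X) Y`. -/
lemma SatisfiesG1.curvature_ξ (hG1 : S.SatisfiesG1) (hX : IsSmoothField I X)
    (hY : IsSmoothField I Y) (x : M) :
    curvature I X Y S.ξ x = S.η x (Y x) • X x - S.η x (X x) • Y x := by
  refine eq_of_forall_inner_eq fun W hW ↦ ?_
  have := hG1 X Y S.ξ W hX hY S.smooth_ξ hW x
  rw [phi_ξ] at this
  simp only [riemann, metric, curvature_zero_right hX hY, Pi.zero_apply, inner_zero_left,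
    inner_zero_right, inner_ξ_right] at this
  rw [inner_sub_left, real_inner_smul_left, real_inner_smul_left]
  linarith

/-- The Riccati type equation for `s` along `ξ`. -/
lemma riccati (hS : S.IsContactMetric) (hG1 : S.SatisfiesG1) (hX : IsSmoothField I X) (x : M) :
    S.s (S.s X) x - (2 : ℝ) • S.h X x + mlieBracket I S.ξ (S.s X) x
      - S.s (mlieBracket I S.ξ X) x = 0 := by
  have hr := hG1.curvature_ξ hX S.smooth_ξ x
  have hφ := isSmoothField_phi (S := S) hX
  have hs := isSmoothField_s (S := S) hX
  have hb := S.smooth_ξ.mlieBracket hX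
  have e0 : leviCivita I S.ξ S.ξ = 0 := by
    rw [leviCivita_ξ_right hS S.smooth_ξ, phi_ξ, s_ξ, neg_zero, add_zero]
  rw [curvature, e0, leviCivita_zero_right hX, leviCivita_ξ_right hS hX,
    leviCivita_ξ_left hS (hφ.neg.add hs), leviCivita_ξ_right hS (hX.mlieBracket S.smooth_ξ),
    mlieBracket_swap (V := X), phi_neg, s_neg hb, phi_add, phi_neg, s_add hφ.neg hs, s_neg hφ,
    s_phi hS hX, phi_s hS hX, S.η_ξ] at hr
  simp only [Pi.add_apply, Pi.neg_apply, bracket_add_right (hφ.neg.diffAt x) (hs.diffAt x),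
    bracket_neg_right (hφ.diffAt x), phi_apply, φ_φ] at hr
  have hh : (2 : ℝ) • S.h X x =
      mlieBracket I S.ξ (S.phi X) x - S.φ x (mlieBracket I S.ξ X x) := by
    rw [h_apply, smul_smul]; norm_num
  rw [hh, ← neg_eq_zero]
  rw [← sub_eq_zero] at hr
  rw [← hr]
  module

lemma s_eq_zero (hS : S.IsContactMetric) (hG1 : S.SatisfiesG1) (hX : IsSmoothField I X) :
    S.s X = 0 := by
  have hφ := isSmoothField_phi (S := S) hX
  have hs := isSmoothField_s (S := S) hX
  have hh := isSmoothField_h (S := S) hX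
  have hb := S.smooth_ξ.mlieBracket hX
  have hbφ := S.smooth_ξ.mlieBracket hφ
  funext x
  have r1 := congrArg (S.φ x) (riccati hS hG1 hX x)
  have r2 := riccati hS hG1 hφ x
  have q1 : S.φ x (S.s (S.s X) x) = S.h (S.s X) x := congrFun (phi_s hS hs) x
  have q2 : S.s (S.s (S.phi X)) x = S.h (S.s X) x := by
    rw [s_phi hS hX, s_neg hh, ← phi_s hS hX, s_phi hS hs, neg_neg]
  have q3 : S.h (S.phi X) x = S.s X x := by
    rw [← phi_s hS hφ, s_phi hS hX, phi_neg, phi_h, neg_neg]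
  have q4 : S.φ x (S.h X x) = - S.s X x := congrFun phi_h x
  have q5 : mlieBracket I S.ξ (S.s (S.phi X)) x = - mlieBracket I S.ξ (S.phi (S.s X)) x := by
    rw [s_phi hS hX, bracket_neg_right (hh.diffAt x), phi_s hS hX]
  have q6 : (2 : ℝ) • S.h (S.s X) x = mlieBracket I S.ξ (S.phi (S.s X)) x
      - S.φ x (mlieBracket I S.ξ (S.s X) x) := by
    rw [h_apply, smul_smul]; norm_num
  have q7 : S.φ x (S.s (mlieBracket I S.ξ X) x)
      = - S.s (S.phi (mlieBracket I S.ξ X)) x := by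
    rw [s_phi hS hb, ← phi_s hS hb, Pi.neg_apply, neg_neg, phi_apply]
  have q8 : S.s (mlieBracket I S.ξ (S.phi X)) x - S.s (S.phi (mlieBracket I S.ξ X)) x
      = - ((2 : ℝ) • S.h (S.s X) x) := by
    have e : mlieBracket I S.ξ (S.phi X) + -S.phi (mlieBracket I S.ξ X) = S.h X + S.h X := by
      rw [h]; module
    have := congrFun (congrArg S.s e) x
    rw [s_add hbφ (isSmoothField_phi hb).neg, s_neg (isSmoothField_phi hb), s_add hh hh,
      ← phi_s hS hX, s_phi hS hs] at this
    simp only [Pi.add_apply, Pi.neg_apply] at this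
    rw [sub_eq_add_neg, this]
    module
  have key : S.φ x (S.s (S.s X) x) = 0 := by
    simp only [map_add, map_sub, map_smul, map_zero, q1, q4, q7] at r1
    rw [q2, q3, q5] at r2
    have : (2 : ℝ) • S.h (S.s X) x = 0 := by
      linear_combination (norm := module) r1 + r2 - q6 + q8
    rw [q1]
    exact (smul_eq_zero.1 this).resolve_left two_ne_zero
  have h2 : S.s (S.s X) x = 0 := by
    have := S.φ_φ x (S.s (S.s X) x)
    rwa [key, map_zero, η_s, zero_smul, add_zero, zero_eq_neg] at this
  have h3 := inner_s_comm hS hX hs x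
  rwa [h2, inner_zero_right, inner_self_eq_zero] at h3

lemma leviCivita_ξ (hS : S.IsContactMetric) (hG1 : S.SatisfiesG1) (hX : IsSmoothField I X) :
    leviCivita I X S.ξ = - S.phi X := by
  rw [leviCivita_ξ_right hS hX, s_eq_zero hS hG1 hX, add_zero]

variable (S) in
/-- The covariant derivative `(∇_X φ) Y`. -/
noncomputable def nablaPhi (X Y : Π x : M, TangentSpace I x) (x : M) : TangentSpace I x :=
  leviCivita I X (S.phi Y) x - S.φ x (leviCivita I X Y x)

lemma nablaPhi_sub_nablaPhi (hS : S.IsContactMetric) (hG1 : S.SatisfiesG1)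
    (hX : IsSmoothField I X) (hY : IsSmoothField I Y) (x : M) :
    S.nablaPhi X Y x - S.nablaPhi Y X x = S.η x (X x) • Y x - S.η x (Y x) • X x := by
  have h := hG1.curvature_ξ hX hY x
  rw [curvature, leviCivita_ξ hS hG1 hX, leviCivita_ξ hS hG1 hY,
    leviCivita_ξ hS hG1 (hX.mlieBracket hY), leviCivita_neg_right hX (isSmoothField_phi hY),
    leviCivita_neg_right hY (isSmoothField_phi hX), Pi.neg_apply, phi_apply,
    ← leviCivita_sub_leviCivita hX hY, map_sub] at h
  rw [nablaPhi, nablaPhi, ← neg_sub (S.η x (Y x) • X x), ← h]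
  abel

lemma inner_nablaPhi_swap (hX : IsSmoothField I X) (hY : IsSmoothField I Y)
    (hZ : IsSmoothField I Z) (x : M) :
    inner ℝ (S.nablaPhi X Y x) (Z x) = - inner ℝ (S.nablaPhi X Z x) (Y x) := by
  have e : metric I (S.phi Y) Z = - metric I Y (S.phi Z) := funext fun x ↦ S.inner_φ_left x _ _
  have h1 := lieDeriv_metric hX (isSmoothField_phi (S := S) hY) hZ x
  rw [e, lieDeriv_neg, lieDeriv_metric hX hY (isSmoothField_phi hZ)] at h1
  simp only [nablaPhi, inner_sub_left, inner_φ_left]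
  simp only [phi_apply] at h1
  linarith

lemma cyclic_inner_nablaPhi (hS : S.IsContactMetric) (hX : IsSmoothField I X)
    (hY : IsSmoothField I Y) (hZ : IsSmoothField I Z) (x : M) :
    inner ℝ (S.nablaPhi X Z x) (Y x) + inner ℝ (S.nablaPhi Y X x) (Z x)
      + inner ℝ (S.nablaPhi Z Y x) (X x) = 0 := by
  have h := cyclic_lieDeriv_metric_phi hS hX hY hZ x
  rw [lieDeriv_metric hX hY (isSmoothField_phi hZ), lieDeriv_metric hY hZ (isSmoothField_phi hX),
    lieDeriv_metric hZ hX (isSmoothField_phi hY)] at h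
  simp only [metric, ← leviCivita_sub_leviCivita hX hY, ← leviCivita_sub_leviCivita hY hZ,
    ← leviCivita_sub_leviCivita hZ hX, inner_sub_left, phi_apply] at h
  simp only [nablaPhi, inner_sub_left, inner_φ_left]
  linarith

/-- The identity `(∇_X φ) Y = g(X, Y) ξ - η(Y) X` characterizing Sasakian structures. -/
lemma nablaPhi_eq (hS : S.IsContactMetric) (hG1 : S.SatisfiesG1)
    (hX : IsSmoothField I X) (hY : IsSmoothField I Y) (x : M) :
    S.nablaPhi X Y x = metric I X Y x • S.ξ x - S.η x (Y x) • X x := by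
  refine eq_of_forall_inner_eq fun Z hZ ↦ ?_
  have h1 := cyclic_inner_nablaPhi hS hX hY hZ x
  have h2 := congrArg (fun v ↦ inner ℝ v (X x)) (nablaPhi_sub_nablaPhi hS hG1 hZ hY x)
  have h3 := inner_nablaPhi_swap (S := S) hX hY hZ x
  have h4 := inner_nablaPhi_swap (S := S) hY hX hZ x
  simp only [metric, inner_sub_left, real_inner_smul_left, inner_ξ_left] at h2 ⊢
  rw [real_inner_comm (X x) (Y x), real_inner_comm (X x) (Z x)] at h2
  linarith

lemma isNormal_of_satisfiesG1 (hS : S.IsContactMetric) (hG1 : S.SatisfiesG1) : S.IsNormal := by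
  intro X Y hX hY x
  have hφX := isSmoothField_phi (S := S) hX
  have hφY := isSmoothField_phi (S := S) hY
  have e : S.nijenhuis X Y x = S.nablaPhi (S.phi X) Y x - S.nablaPhi (S.phi Y) X x
      + S.φ x (S.nablaPhi Y X x) - S.φ x (S.nablaPhi X Y x) := by
    simp only [nijenhuis, ← leviCivita_sub_leviCivita hX hY,
      ← leviCivita_sub_leviCivita hφX hφY, ← leviCivita_sub_leviCivita hφX hY,
      ← leviCivita_sub_leviCivita hX hφY, nablaPhi, map_sub]
    abel
  rw [e, nablaPhi_eq hS hG1 hφX hY, nablaPhi_eq hS hG1 hφY hX, nablaPhi_eq hS hG1 hX hY,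
    nablaPhi_eq hS hG1 hY hX, hS X Y hX hY]
  simp only [metric, phi_apply, inner_φ_left, map_sub, map_smul, φ_ξ, smul_zero,
    real_inner_comm (Y x) (S.φ x (X x))]
  rw [← real_inner_comm (X x), inner_φ_left]
  module

end Contact

end AlmostContactMetricStructure

end ContactGeometry

theorem mainTheorem5 {n : ℕ} {M : Type*} [TopologicalSpace M] [T2Space M]
    [ChartedSpace (EuclideanSpace ℝ (Fin (2 * n + 1))) M] [IsManifold (𝓡 (2 * n + 1)) ∞ M]
    [Bundle.RiemannianBundle (fun x : M ↦ TangentSpace (𝓡 (2 * n + 1)) x)]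
    [IsContMDiffRiemannianBundle (𝓡 (2 * n + 1)) ∞ (EuclideanSpace ℝ (Fin (2 * n + 1)))
      (fun x : M ↦ TangentSpace (𝓡 (2 * n + 1)) x)]
    (S : ContactGeometry.AlmostContactMetricStructure (𝓡 (2 * n + 1)) M)
    (hS : S.IsContactMetric) (hG1 : S.SatisfiesG1) :
    S.IsSasakian :=
  ⟨hS, ContactGeometry.AlmostContactMetricStructure.isNormal_of_satisfiesG1 hS hG1⟩
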